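/- Let $n\in\mathbb N$, let $N$ be a set of $n$ agents and $M$ a set of $n$ items. A preference profile $R=(\succ_j)_{j\in N}$ gives each agent $j$ a strict linear order $\succ_j$ over $M$; the top item of $j$ in $S\subseteq M$ is the $\succ_j$-best item of $S$, and $U(\succ_j,o)=\{o'\in M: o'\succ_j o\}\cup\{o\}$. A deterministic assignment is a bijection $A:N\to M$, identified with its $0/1$ matrix; a random assignment is a doubly stochastic matrix $P=[p_{j,o}]_{j\in N,o\in M}$, with rows $P_j$. For $p,q\in\mathbb R^M$ write $p\succeq^{sd}_j q$ if $\sum_{o'\in U(\succ_j,o)}p_{o'}\ge\sum_{o'\in U(\succ_j,o)}q_{o'}$ for all $o\in M$. A mechanism maps every profile to a random assignment. The eager Boston mechanism (EBM) starts with all items and all agents remaining. While items remain, it plays a round: every remaining agent applies for her top item among the remaining items; for each remaining item $o$ with a nonempty set $N_o$ of applicants, an agent drawn uniformly at random from $N_o$, independently across lotteries, is allocated $o$; then all items that had applicants and all winners are removed. Let $\mathbb E(\mathrm{EBM}(R))$ be the matrix whose $(j,o)$ entry is the probability that $j$ is allocated $o$. For a deterministic assignment $A$ define recursively, for $r=1,2,\dots$,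 the set $T_{A,r}$ of the items $o$ such that $o$ is the top item in $M\setminus\bigcup_{r'<r}T_{A,r'}$ of some agent $j$ with $A(j)\notin\bigcup_{r'<r}T_{A,r'}$. The assignment $A$ satisfies FERI (favoring-eagerness-for-remaining-items) if, for every $r\ge1$, every $o\in T_{A,r}$ is the top item in $M\setminus\bigcup_{r'<r}T_{A,r'}$ of the agent $A^{-1}(o)$. The common prefix of $\succ_j$ and $\succ_k$ is the longest sequence of items that is an initial segment of both orders. **Theorem.** For every profile $R$, the matrix $P=\mathbb E(\mathrm{EBM}(R))$ is a random assignment such that 1. (ex-post FERI) $P$ is a convex combination of deterministic assignments that satisfy FERI; 2. (sd-weak-envy-freeness) for all $j,k\in N$, if $P_k\succeq^{sd}_j P_j$ then $P_j=P_k$; 3. (strong equal treatment of equals) for all $j,k\in N$, $p_{j,o}=p_{k,o}$ for every item $o$ in the common prefix of $\succ_j$ and $\succ_k$. Moreover, EBM is sd-weakly strategyproof: for every profile $R$, every agent $j$ and every profile $R'$ obtained from $R$ by replacing $\succ_j$ by some strict linear order $\succ'_j$ over $M$, if $\mathbb E(\mathrm{EBM}(R'))_j\succeq^{sd}_j\mathbb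 E(\mathrm{EBM}(R))_j$ (dominance with respect to $\succ_j$), then $\mathbb E(\mathrm{EBM}(R'))_j=\mathbb E(\mathrm{EBM}(R))_j$. -/

import Mathlib

/-! ## Assignment problems with `n` agents and `n` items -/

abbrev Agent (n : ℕ) : Type := Fin n

abbrev Item (n : ℕ) : Type := Fin n

/-- A strict linear order over the items; `prefers a b` reads `a ≻ b`. -/
structure Preference (n : ℕ) where
  prefers : Item n → Item n → Prop
  strictLinear : IsStrictTotalOrder (Item n) prefers

abbrev Profile (n : ℕ) : Type := Agent n → Preference n

namespace Preference

variable {n : ℕ}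

open Classical in
/-- Upper contour set `{o' | o' ≻ o} ∪ {o}`. -/
noncomputable def upperContour (p : Preference n) (o : Item n) : Finset (Item n) :=
  Finset.univ.filter fun o' => p.prefers o' o ∨ o' = o

/-- The rank of an item: the best item has rank `1`. -/
noncomputable def rank (p : Preference n) (o : Item n) : ℕ := (p.upperContour o).card

/-- `o` is the item ranked highest among the items of `S` (no such item exists if `S` is empty). -/
def IsTop (p : Preference n) (S : Finset (Item n)) (o : Item n) : Prop :=
  o ∈ S ∧ ∀ o' ∈ S, o' ≠ o → p.prefers o o'

/-- `C` is the set of items that appear in the common prefix of `p` and `q`: its items have in both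
orders the same rank, which is at most `|C|`, and the top items outside `C` (if any) differ. -/
def IsCommonPrefix (p q : Preference n) (C : Finset (Item n)) : Prop :=
  (∀ o ∈ C, p.rank o = q.rank o ∧ p.rank o ≤ C.card) ∧
    ∀ o o', p.IsTop Cᶜ o → q.IsTop Cᶜ o' → o ≠ o'

/-- `x` (weakly) stochastically dominates `y` with respect to `p`. -/
def StochDom (p : Preference n) (x y : Item n → ℝ) : Prop :=
  ∀ o, ∑ o' ∈ p.upperContour o, y o' ≤ ∑ o' ∈ p.upperContour o, x o'

end Preference

/-! ## Deterministic and random assignments, mechanisms -/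

/-- A one-to-one mapping from agents to items. -/
abbrev DetAssignment (n : ℕ) : Type := Agent n ≃ Item n

abbrev ShareMatrix (n : ℕ) : Type := Matrix (Agent n) (Item n) ℝ

def DetAssignment.toMatrix {n : ℕ} (A : DetAssignment n) : ShareMatrix n :=
  fun j o => if A j = o then 1 else 0

/-- A random assignment is a doubly stochastic matrix. -/
def IsRandomAssignment {n : ℕ} (P : ShareMatrix n) : Prop :=
  P ∈ doublyStochastic ℝ (Fin n)

/-- `P` is a convex combination of deterministic assignments with the property `X`. -/
def ExPost {n : ℕ} (X : DetAssignment n → Prop) (P : ShareMatrix n) : Prop :=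
  P ∈ convexHull ℝ (DetAssignment.toMatrix '' {A | X A})

section FERI

variable {n : ℕ}

open Classical in
/-- Given the set `U` of items in the earlier tiers, the items `o ∉ U` that are the top item outside
`U` of some agent whose own item is not in `U`. -/
noncomputable def nextTier (R : Profile n) (A : DetAssignment n) (U : Finset (Item n)) :
    Finset (Item n) :=
  Finset.univ.filter fun o => ∃ j, A j ∉ U ∧ (R j).IsTop Uᶜ o

/-- The union of the first `r` tiers. -/
noncomputable def tiersBefore (R : Profile n) (A : DetAssignment n) : ℕ → Finset (Item n)
  | 0 => ∅
  | r + 1 => tiersBefore R A r ∪ nextTier R A (tiersBefore R A r)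

/-- The tier number `r + 1`, i.e. the tiers are numbered from `0` here. -/
noncomputable def tier (R : Profile n) (A : DetAssignment n) (r : ℕ) : Finset (Item n) :=
  nextTier R A (tiersBefore R A r)

/-- Favoring-eagerness-for-remaining-items: every item of every tier is assigned to an agent for
whom it is the top item outside the earlier tiers. -/
def FERI (R : Profile n) (A : DetAssignment n) : Prop :=
  ∀ r, ∀ o ∈ tier R A r, (R (A.symm o)).IsTop (tiersBefore R A r)ᶜ o

end FERI

/-- No agent's allocation is dominated by a different allocation of another agent. -/
def SdWeakEnvyFree {n : ℕ} (R : Profile n) (P : ShareMatrix n) : Prop :=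
  ∀ j k, (R j).StochDom (P k) (P j) → P j = P k

/-- Any two agents have the same shares of the items in the common prefix of their preferences. -/
def StrongEqualTreatmentOfEquals {n : ℕ} (R : Profile n) (P : ShareMatrix n) : Prop :=
  ∀ j k C, (R j).IsCommonPrefix (R k) C → ∀ o ∈ C, P j o = P k o

/-- No misreport `p` of an agent `j` yields her an allocation that dominates, with respect to her
true preference `R j`, the one for the truthful report and differs from it. -/
def SdWeakStrategyproof {n : ℕ} (f : Profile n → ShareMatrix n) : Prop :=
  ∀ (R : Profile n) (j : Agent n) (p : Preference n),
    (R j).StochDom (f (Function.update R j p) j) (f R j) → f (Function.update R j p) j = f R j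

/-! ## The eager Boston mechanism -/

/-- Independent draws: one from each of the distributions `d i`. -/
noncomputable def independentDraws {ι α : Type} [Fintype ι] [DecidableEq ι] [Fintype α]
    (d : ι → PMF α) : PMF (ι → α) :=
  PMF.ofFintype (fun w => ∏ i, d i (w i)) (by
    rw [← Fintype.prod_sum]
    refine Finset.prod_eq_one fun i _ => ?_
    rw [← tsum_fintype (L := .unconditional _)]
    exact (d i).tsum_coe)

namespace EBM

variable {n : ℕ}

/-- The variables of the algorithm: the remaining items, the remaining agents, and the item (if any)
that each agent has been allocated. -/
structure State (n : ℕ) where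
  items : Finset (Item n)
  agents : Finset (Agent n)
  alloc : Agent n → Option (Item n)

def State.initial : State n := ⟨Finset.univ, Finset.univ, fun _ => none⟩

open Classical in
/-- The remaining agents who apply for `o`. -/
noncomputable def State.applicants (R : Profile n) (s : State n) (o : Item n) : Finset (Agent n) :=
  s.agents.filter fun j => (R j).IsTop s.items o

open Classical in
/-- The winner of a lottery among the agents of `S`, drawn uniformly at random; there is no winner
(`none`) if `S` is empty. -/
noncomputable def lottery (S : Finset (Agent n)) : PMF (Option (Agent n)) :=
  if h : S.Nonempty then (PMF.uniformOfFinset S h).map some else PMF.pure none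

open Classical in
/-- The end of a round in which the item `o` was won by `winner o`. -/
noncomputable def State.update (R : Profile n) (s : State n)
    (winner : Item n → Option (Agent n)) : State n where
  items := s.items.filter fun o => s.applicants R o = ∅
  agents := s.agents.filter fun j => ∀ o, winner o ≠ some j
  alloc := fun j => if h : ∃ o, winner o = some j then some h.choose else s.alloc j

/-- One round: independent lotteries for all the items, each among the applicants for it. -/
noncomputable def round (R : Profile n) (s : State n) : PMF (State n) :=
  (independentDraws fun o => lottery (s.applicants R o)).map (s.update R)

/-- The loop that plays rounds while items remain, cut off after the given number of rounds. -/
noncomputable def loop (R : Profile n) : ℕ → State n → PMF (State n)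
  | 0, s => PMF.pure s
  | r + 1, s => if s.items = ∅ then PMF.pure s else (round R s).bind (loop R r)

/-- The distribution of the outcome. Every round allocates an item, so `n` rounds suffice. -/
noncomputable def outcome (R : Profile n) : PMF (Agent n → Option (Item n)) :=
  (loop R n State.initial).map State.alloc

/-- The expected outcome: the entry at `(j, o)` is the probability that `j` is allocated `o`. -/
noncomputable def expectedOutcome (R : Profile n) : ShareMatrix n :=
  fun j o => ∑ A, (outcome R A).toReal * if A j = some o then 1 else 0

end EBM

/-!
Follow two runs of the mechanism that differ only in the report of one agent `j`, or in the names of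
the agents. As long as the two reports of `j` have the same top remaining item, every lottery has
the same applicants up to renaming, so the runs can be coupled. In the first round in which these
tops `a` and `b` differ, `j` gets a larger share of `a` in the run in which she applies for it: if
someone applies for `a` in the other run, then her share of `a` is zero there; if no one does, then
she is the only applicant in her own run and obtains `a` for sure, whereas in the other run she may
win `b`. All items that she prefers to `a` are already gone at that point. Hence the difference of
the two expected allocations of `j` is lexicographically nonnegative, with a leading entry at which
the two reports already disagree; this yields envy-freeness, equal treatment and strategyproofness
at once. For FERI, the tiers of the final assignment of a run are exactly the sets of items removed
in its rounds.
-/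

/-! ### Expectations on finite probability spaces -/

section Expectation

variable {α β E : Type*} [Fintype α] [Fintype β] [AddCommGroup E] [Module ℝ E]

/-- The expected value of a vector-valued function on a finite probability space, as a finite sum
(which needs no topology on `E`). -/
noncomputable def expectation (μ : PMF α) (f : α → E) : E :=
  ∑ a, (μ a).toReal • f a

theorem sum_toReal_pmf (μ : PMF α) : ∑ a, (μ a).toReal = 1 := by
  rw [← ENNReal.toReal_sum fun a _ => μ.apply_ne_top a, ← tsum_fintype (L := .unconditional _),
    μ.tsum_coe, ENNReal.toReal_one]

theorem expectation_mem_of_convex {μ : PMF α} {f : α → E} {s : Set E} (hs : Convex ℝ s)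
    (hf : ∀ a ∈ μ.support, f a ∈ s) : expectation μ f ∈ s := by
  rw [expectation, ← finsum_eq_sum_of_fintype]
  refine hs.finsum_mem (fun _ => ENNReal.toReal_nonneg) ?_ fun a ha => hf a ?_
  · rw [finsum_eq_sum_of_fintype, sum_toReal_pmf]
  · exact (μ.mem_support_iff a).2 fun h => ha (by rw [h, ENNReal.toReal_zero])

theorem expectation_eq_of_forall_mem_support {μ : PMF α} {f : α → E} {x : E}
    (hf : ∀ a ∈ μ.support, f a = x) : expectation μ f = x :=
  expectation_mem_of_convex (convex_singleton x) hf

theorem expectation_pos {μ : PMF α} {f : α → ℝ} (hf : ∀ a, 0 ≤ f a) {a : α} (ha : a ∈ μ.support)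
    (hfa : 0 < f a) : 0 < expectation μ f :=
  Finset.sum_pos' (fun b _ => mul_nonneg ENNReal.toReal_nonneg (hf b))
    ⟨a, Finset.mem_univ a, mul_pos
      (ENNReal.toReal_pos ((μ.mem_support_iff a).1 ha) (μ.apply_ne_top a)) hfa⟩

theorem expectation_apply {ι : Type*} {F : ι → Type*} [∀ i, AddCommGroup (F i)]
    [∀ i, Module ℝ (F i)] (μ : PMF α) (f : α → ∀ i, F i) (i : ι) :
    expectation μ f i = expectation μ fun a => f a i := by
  simp only [expectation, Finset.sum_apply, Pi.smul_apply]

theorem expectation_sub (μ : PMF α) (f g : α → E) :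
    expectation μ f - expectation μ g = expectation μ fun a => f a - g a := by
  simp only [expectation, smul_sub, Finset.sum_sub_distrib]

theorem expectation_pure (a : α) (f : α → E) : expectation (PMF.pure a) f = f a :=
  expectation_eq_of_forall_mem_support fun b hb => by rw [(PMF.mem_support_pure_iff a b).1 hb]

theorem expectation_bind (μ : PMF α) (κ : α → PMF β) (f : β → E) :
    expectation (μ.bind κ) f = expectation μ fun a => expectation (κ a) f := by
  have hbind (b : β) : (μ.bind κ b).toReal = ∑ a, (μ a).toReal * (κ a b).toReal := by
    rw [PMF.bind_apply, tsum_fintype, ENNReal.toReal_sum fun a _ =>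
      ENNReal.mul_ne_top (μ.apply_ne_top a) ((κ a).apply_ne_top b)]
    simp only [ENNReal.toReal_mul]
  simp only [expectation, hbind, Finset.sum_smul, Finset.smul_sum, smul_smul]
  exact Finset.sum_comm

theorem expectation_map (μ : PMF α) (g : α → β) (f : β → E) :
    expectation (μ.map g) f = expectation μ fun a => f (g a) := by
  simp only [← PMF.bind_pure_comp, expectation_bind, Function.comp_apply, expectation_pure]

end Expectation

theorem map_eq_pure_of_forall_mem_support {α β : Type*} {μ : PMF α} {f : α → β} {b : β}
    (hf : ∀ a ∈ μ.support, f a = b) : μ.map f = PMF.pure b := by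
  have hsupp : (μ.map f).support = {b} := by
    rw [PMF.support_map, Set.image_congr hf, μ.support_nonempty.image_const]
  ext x
  rcases eq_or_ne x b with rfl | hx
  · rw [(PMF.apply_eq_one_iff _ x).2 hsupp, PMF.pure_apply_self]
  · rw [(PMF.apply_eq_zero_iff _ x).2 (by simpa [hsupp] using hx), PMF.pure_apply_of_ne b x hx]

section IndependentDraws

variable {ι α β : Type} [Fintype ι] [DecidableEq ι] [Fintype α] [Fintype β]

theorem mem_support_independentDraws {d : ι → PMF α} {w : ι → α} :
    w ∈ (independentDraws d).support ↔ ∀ i, w i ∈ (d i).support := by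
  simp only [PMF.mem_support_iff, independentDraws, PMF.ofFintype_apply, ne_eq,
    Finset.prod_eq_zero_iff, Finset.mem_univ, true_and, not_exists]

theorem expectation_independentDraws_equiv {E : Type*} [AddCommGroup E] [Module ℝ E]
    {d : ι → PMF α} {d' : ι → PMF β} (e : α ≃ β) (h : ∀ i a, d' i (e a) = d i a)
    (f : (ι → β) → E) :
    expectation (independentDraws d') f =
      expectation (independentDraws d) fun w => f fun i => e (w i) := by
  refine (Fintype.sum_equiv (Equiv.piCongrRight fun _ => e) _ _ fun w => ?_).symm
  simp only [independentDraws, PMF.ofFintype_apply, Equiv.piCongrRight_apply, Pi.map_apply, h]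
  rfl

end IndependentDraws

/-! ### Preferences -/

namespace Preference

variable {n : ℕ} {p q : Preference n} {S C : Finset (Item n)} {a b c o : Item n}

instance (p : Preference n) : IsStrictTotalOrder (Item n) p.prefers := p.strictLinear

theorem mem_upperContour : b ∈ p.upperContour a ↔ p.prefers b a ∨ b = a := by
  simp only [upperContour, Finset.mem_filter_univ]

theorem mem_upperContour_self : a ∈ p.upperContour a :=
  mem_upperContour.2 (.inr rfl)

theorem upperContour_ssubset_of_prefers (h : p.prefers a b) :
    p.upperContour a ⊂ p.upperContour b := by
  refine Finset.ssubset_iff_of_subset (fun c hc => ?_) |>.2 ⟨b, mem_upperContour_self, fun hb => ?_⟩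
  · rcases mem_upperContour.1 hc with hc | rfl
    · exact mem_upperContour.2 (.inl (trans_of p.prefers hc h))
    · exact mem_upperContour.2 (.inl h)
  · rcases mem_upperContour.1 hb with hb | rfl
    · exact asymm_of p.prefers h hb
    · exact irrefl_of p.prefers b h

theorem rank_lt_rank (h : p.prefers a b) : p.rank a < p.rank b :=
  Finset.card_lt_card (upperContour_ssubset_of_prefers h)

theorem prefers_of_rank_lt_rank (h : p.rank a < p.rank b) : p.prefers a b := by
  rcases trichotomous_of p.prefers a b with hab | rfl | hba
  · exact hab
  · exact absurd h (lt_irrefl _)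
  · exact absurd (rank_lt_rank hba) h.not_gt

theorem rank_injective (p : Preference n) : Function.Injective p.rank := fun a b h => by
  rcases trichotomous_of p.prefers a b with hab | hab | hba
  · exact absurd h (rank_lt_rank hab).ne
  · exact hab
  · exact absurd h (rank_lt_rank hba).ne'

theorem mem_upperContour_iff_rank_le : b ∈ p.upperContour a ↔ p.rank b ≤ p.rank a := by
  rw [mem_upperContour, le_iff_lt_or_eq, p.rank_injective.eq_iff]
  exact or_congr_left ⟨rank_lt_rank, prefers_of_rank_lt_rank⟩

theorem exists_isTop (p : Preference n) (hS : S.Nonempty) : ∃ a, p.IsTop S a := by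
  obtain ⟨a, ha, hmin⟩ := S.exists_min_image p.rank hS
  exact ⟨a, ha, fun b hb hba => prefers_of_rank_lt_rank
    ((hmin b hb).lt_of_ne (p.rank_injective.ne hba.symm))⟩

theorem IsTop.eq (ha : p.IsTop S a) (hb : p.IsTop S b) : a = b := by
  by_contra hab
  exact asymm_of p.prefers (ha.2 b hb.1 (Ne.symm hab)) (hb.2 a ha.1 hab)

theorem IsTop.notMem_of_prefers (ha : p.IsTop S a) (h : p.prefers b a) : b ∉ S := fun hb =>
  asymm_of p.prefers h (ha.2 b hb fun hba => irrefl_of p.prefers a (hba ▸ h))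

theorem exists_isTop_ne (h : ¬∀ o, p.IsTop S o ↔ q.IsTop S o) :
    ∃ a b, p.IsTop S a ∧ q.IsTop S b ∧ a ≠ b := by
  have hS : S.Nonempty := Finset.nonempty_iff_ne_empty.2 fun hS =>
    h fun o => iff_of_false (fun ho => by simpa [hS] using ho.1) fun ho => by simpa [hS] using ho.1
  obtain ⟨a, ha⟩ := p.exists_isTop hS
  obtain ⟨b, hb⟩ := q.exists_isTop hS
  refine ⟨a, b, ha, hb, ?_⟩
  rintro rfl
  exact h fun o => ⟨fun ho => ha.eq ho ▸ hb, fun ho => hb.eq ho ▸ ha⟩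

theorem mem_of_rank_le_card (hC : ∀ o ∈ C, p.rank o ≤ C.card) (ha : p.rank a ≤ C.card) :
    a ∈ C := by
  have hcard : (Finset.univ.filter fun o => p.rank o ≤ C.card).card ≤ (Finset.Icc 1 C.card).card :=
    Finset.card_le_card_of_injOn p.rank
      (fun o ho => Finset.mem_Icc.2 ⟨Finset.card_pos.2 ⟨o, mem_upperContour_self⟩,
        (Finset.mem_filter.1 ho).2⟩)
      p.rank_injective.injOn
  rw [Nat.card_Icc, Nat.add_sub_cancel] at hcard
  rw [Finset.eq_of_subset_of_card_le
    (fun o ho => Finset.mem_filter.2 ⟨Finset.mem_univ o, hC o ho⟩) hcard]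
  exact Finset.mem_filter.2 ⟨Finset.mem_univ a, ha⟩

theorem IsCommonPrefix.upperContour_eq (hC : p.IsCommonPrefix q C) (ho : o ∈ C) :
    p.upperContour o = q.upperContour o := by
  have hp : ∀ c ∈ C, p.rank c ≤ C.card := fun c hc => (hC.1 c hc).2
  have hq : ∀ c ∈ C, q.rank c ≤ C.card := fun c hc => (hC.1 c hc).1 ▸ hp c hc
  ext c
  rw [mem_upperContour_iff_rank_le, mem_upperContour_iff_rank_le]
  constructor <;> intro hco
  · rwa [← (hC.1 o ho).1, ← (hC.1 c (mem_of_rank_le_card hp (hco.trans (hp o ho)))).1]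
  · rwa [(hC.1 o ho).1, (hC.1 c (mem_of_rank_le_card hq (hco.trans (hq o ho)))).1]

theorem IsCommonPrefix.prefers_of_notMem (hC : p.IsCommonPrefix q C) (ho : o ∈ C) (ha : a ∉ C) :
    p.prefers o a :=
  prefers_of_rank_lt_rank <| (hC.1 o ho).2.trans_lt <| not_le.1 fun h =>
    ha (mem_of_rank_le_card (fun c hc => (hC.1 c hc).2) h)

theorem upperContour_ne_of_isTop_ne (ha : p.IsTop S a) (hb : q.IsTop S b) (hab : a ≠ b) :
    p.upperContour a ≠ q.upperContour a := by
  intro h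
  have hba : b ∈ p.upperContour a := h ▸ mem_upperContour.2 (.inl (hb.2 a ha.1 hab))
  rcases mem_upperContour.1 hba with hba | hba
  · exact ha.notMem_of_prefers hba hb.1
  · exact hab hba.symm

/-- The cone of the vectors that are zero or have, in the order `p`, a positive leading entry, at an
item whose upper contour sets in `p` and `q` differ. The difference of two allocations lies in it if
the first one is better for `p` from a point on at which `p` and `q` already disagree. -/
def divergenceCone (p q : Preference n) : PointedCone ℝ (Item n → ℝ) where
  carrier := {v | v = 0 ∨ ∃ a, p.upperContour a ≠ q.upperContour a ∧ 0 < v a ∧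
    ∀ o, p.prefers o a → v o = 0}
  zero_mem' := .inl rfl
  add_mem' := by
    rintro v w (rfl | ⟨a, hpqa, hva, hv⟩) (rfl | ⟨b, hpqb, hwb, hw⟩)
    · exact .inl (add_zero 0)
    · exact .inr ⟨b, hpqb, by simpa using hwb, fun o ho => by simp [hw o ho]⟩
    · exact .inr ⟨a, hpqa, by simpa using hva, fun o ho => by simp [hv o ho]⟩
    · rcases trichotomous_of p.prefers a b with hab | rfl | hba
      · exact .inr ⟨a, hpqa, by simpa [hw a hab] using hva, fun o ho => by
          simp [hv o ho, hw o (trans_of p.prefers ho hab)]⟩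
      · exact .inr ⟨a, hpqa, add_pos hva hwb, fun o ho => by simp [hv o ho, hw o ho]⟩
      · exact .inr ⟨b, hpqb, by simpa [hv b hba] using hwb, fun o ho => by
          simp [hw o ho, hv o (trans_of p.prefers ho hba)]⟩
  smul_mem' := by
    rintro ⟨c, hc⟩ v (rfl | ⟨a, hpqa, hva, hv⟩)
    · exact .inl (smul_zero _)
    · rcases hc.eq_or_lt with rfl | hc
      · exact .inl (zero_smul _ v)
      · exact .inr ⟨a, hpqa, mul_pos hc hva, fun o ho => by simp [hv o ho]⟩

theorem convex_divergenceCone (p q : Preference n) :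
    Convex ℝ (p.divergenceCone q : Set (Item n → ℝ)) :=
  (p.divergenceCone q).toConvexCone.convex

theorem mem_divergenceCone_of_isTop_ne {v : Item n → ℝ} (ha : p.IsTop S a) (hb : q.IsTop S b)
    (hab : a ≠ b) (hva : 0 < v a) (hv : ∀ o ∉ S, v o = 0) : v ∈ p.divergenceCone q :=
  .inr ⟨a, upperContour_ne_of_isTop_ne ha hb hab, hva, fun o ho => hv o (ha.notMem_of_prefers ho)⟩

theorem StochDom.eq_of_sub_mem_divergenceCone {x y : Item n → ℝ} (h : p.StochDom y x)
    (hxy : x - y ∈ p.divergenceCone q) : x = y := by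
  rcases hxy with hzero | ⟨a, -, hpos, hzero⟩
  · exact sub_eq_zero.1 hzero
  · refine absurd (h a) (Finset.sum_lt_sum (fun o ho => ?_)
      ⟨a, mem_upperContour_self, sub_pos.1 hpos⟩).not_ge
    rcases mem_upperContour.1 ho with ho | rfl
    · exact (sub_eq_zero.1 (hzero o ho)).ge
    · exact (sub_pos.1 hpos).le

theorem IsCommonPrefix.eq_zero_of_mem_divergenceCone (hC : p.IsCommonPrefix q C)
    {v : Item n → ℝ} (hv : v ∈ p.divergenceCone q) (ho : o ∈ C) : v o = 0 := by
  rcases hv with rfl | ⟨a, hpqa, -, hzero⟩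
  · rfl
  · exact hzero o (hC.prefers_of_notMem ho fun ha => hpqa (hC.upperContour_eq ha))

end Preference

/-! ### Single rounds -/

namespace EBM

variable {n : ℕ} {R R' : Profile n} {s t : State n} {w : Item n → Option (Agent n)}
  {i j : Agent n} {a o : Item n}

noncomputable instance : Fintype (State n) :=
  Fintype.ofInjective (fun s : State n => (s.items, s.agents, s.alloc)) <| by
    rintro ⟨⟩ ⟨⟩ h
    simpa only [Prod.mk.injEq, State.mk.injEq] using h

theorem lottery_some (S : Finset (Agent n)) (i : Agent n) :
    lottery S (some i) = if i ∈ S then (S.card : ENNReal)⁻¹ else 0 := by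
  rcases S.eq_empty_or_nonempty with rfl | hS
  · simp [lottery]
  · simp only [lottery, hS, dif_pos, PMF.map_apply, Option.some_inj]
    rw [tsum_eq_single i fun b hb => if_neg hb.symm]
    simp [PMF.uniformOfFinset_apply]

theorem lottery_none (S : Finset (Agent n)) : lottery S none = if S = ∅ then 1 else 0 := by
  rcases S.eq_empty_or_nonempty with rfl | hS
  · simp [lottery]
  · simp [lottery, hS, PMF.map_apply, hS.ne_empty]

theorem some_mem_support_lottery {S : Finset (Agent n)} :
    some i ∈ (lottery S).support ↔ i ∈ S := by
  simp [PMF.mem_support_iff, lottery_some]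

theorem none_mem_support_lottery {S : Finset (Agent n)} :
    none ∈ (lottery S).support ↔ S = ∅ := by
  simp [PMF.mem_support_iff, lottery_none]

theorem lottery_map_perm (S : Finset (Agent n)) (σ : Equiv.Perm (Agent n))
    (v : Option (Agent n)) : lottery (S.map σ.toEmbedding) (v.map σ) = lottery S v := by
  cases v with
  | none => simp [lottery_none]
  | some i => simp [lottery_some]

/-- The lotteries of a round that starts in the state `s` can have the winners `w`. -/
def IsDraw (R : Profile n) (s : State n) (w : Item n → Option (Agent n)) : Prop :=
  ∀ o, w o ∈ (lottery (s.applicants R o)).support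

theorem mem_support_draws :
    w ∈ (independentDraws fun o => lottery (s.applicants R o)).support ↔ IsDraw R s w :=
  mem_support_independentDraws

theorem State.mem_applicants :
    j ∈ s.applicants R o ↔ j ∈ s.agents ∧ (R j).IsTop s.items o := by
  simp only [State.applicants, Finset.mem_filter]

theorem State.mem_update_items :
    o ∈ (s.update R w).items ↔ o ∈ s.items ∧ s.applicants R o = ∅ := by
  simp only [State.update, Finset.mem_filter]

theorem State.mem_update_agents :
    j ∈ (s.update R w).agents ↔ j ∈ s.agents ∧ ∀ o, w o ≠ some j := by
  simp only [State.update, Finset.mem_filter]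

theorem IsDraw.mem_applicants (hw : IsDraw R s w) (h : w o = some j) : j ∈ s.applicants R o :=
  some_mem_support_lottery.1 (h ▸ hw o)

theorem IsDraw.mem_agents (hw : IsDraw R s w) (h : w o = some j) : j ∈ s.agents :=
  (State.mem_applicants.1 (hw.mem_applicants h)).1

theorem IsDraw.isTop (hw : IsDraw R s w) (h : w o = some j) : (R j).IsTop s.items o :=
  (State.mem_applicants.1 (hw.mem_applicants h)).2

theorem IsDraw.exists_winner (hw : IsDraw R s w) (ho : (s.applicants R o).Nonempty) :
    ∃ j, w o = some j :=
  Option.ne_none_iff_exists'.1 fun h => ho.ne_empty (none_mem_support_lottery.1 (h ▸ hw o))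

theorem exists_isDraw_of_mem_applicants (hj : j ∈ s.applicants R a) :
    ∃ w, IsDraw R s w ∧ w a = some j := by
  choose w hw using fun o => (lottery (s.applicants R o)).support_nonempty
  exact ⟨Function.update w a (some j),
    (Function.forall_update_iff w fun o v => v ∈ (lottery (s.applicants R o)).support).2
      ⟨some_mem_support_lottery.2 hj, fun o _ => hw o⟩,
    Function.update_self a (some j) w⟩

theorem IsDraw.alloc_of_wins (hw : IsDraw R s w) (h : w o = some j) :
    (s.update R w).alloc j = some o := by
  have hex : ∃ o, w o = some j := ⟨o, h⟩
  simp only [State.update, hex, dif_pos, Option.some_inj]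
  exact (hw.isTop hex.choose_spec).eq (hw.isTop h)

theorem State.alloc_of_loses (h : ∀ o, w o ≠ some j) : (s.update R w).alloc j = s.alloc j := by
  simp only [State.update, h, exists_false, dif_neg, not_false_eq_true]

theorem IsDraw.alloc_of_notMem (hw : IsDraw R s w) (hj : j ∉ s.agents) :
    (s.update R w).alloc j = s.alloc j :=
  State.alloc_of_loses fun _ h => hj (hw.mem_agents h)

theorem State.notMem_update_agents (h : w o = some j) : j ∉ (s.update R w).agents := fun hj =>
  (State.mem_update_agents.1 hj).2 o h

/-! ### Runs -/

theorem round_of_items_eq_empty (hs : s.items = ∅) : round R s = PMF.pure s := by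
  refine map_eq_pure_of_forall_mem_support fun w hw => ?_
  have hlose (o : Item n) (j : Agent n) : w o ≠ some j := fun h => by
    simpa [hs] using ((mem_support_draws.1 hw).isTop h).1
  obtain ⟨items, agents, alloc⟩ := s
  subst hs
  simp [State.update, hlose]

theorem loop_succ (R : Profile n) (r : ℕ) (s : State n) :
    loop R (r + 1) s = (round R s).bind (loop R r) := by
  by_cases hs : s.items = ∅
  · rw [round_of_items_eq_empty hs, PMF.pure_bind, loop, if_pos hs]
    cases r with
    | zero => rfl
    | succ r => rw [loop, if_pos hs]
  · rw [loop, if_neg hs]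

theorem mem_support_loop_succ {r : ℕ} :
    t ∈ (loop R (r + 1) s).support ↔
      ∃ w, IsDraw R s w ∧ t ∈ (loop R r (s.update R w)).support := by
  simp only [loop_succ, round, PMF.mem_support_bind_iff, PMF.mem_support_map_iff,
    mem_support_draws, exists_exists_and_eq_and]

theorem loop_invariant {P : State n → Prop}
    (hstep : ∀ s w, IsDraw R s w → P s → P (s.update R w)) {r : ℕ} (hs : P s)
    (ht : t ∈ (loop R r s).support) : P t := by
  induction r generalizing s with
  | zero => rwa [(PMF.mem_support_pure_iff s t).1 ht]
  | succ r ih =>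
    obtain ⟨w, hw, ht⟩ := mem_support_loop_succ.1 ht
    exact ih (hstep s w hw hs) ht

theorem alloc_eq_of_mem_support_loop {r : ℕ} (ht : t ∈ (loop R r s).support)
    (hj : j ∉ s.agents) : t.alloc j = s.alloc j := by
  refine (loop_invariant (P := fun u => j ∉ u.agents ∧ u.alloc j = s.alloc j)
    (fun u w hw hu => ⟨fun h => hu.1 (State.mem_update_agents.1 h).1, ?_⟩) ⟨hj, rfl⟩ ht).2
  rw [hw.alloc_of_notMem hu.1, hu.2]

theorem mem_items_of_mem_support_loop {r : ℕ} (ht : t ∈ (loop R r s).support)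
    (hj : s.alloc j = none) (ho : t.alloc j = some o) : o ∈ s.items := by
  refine (loop_invariant (P := fun u => u.items ⊆ s.items ∧ ∀ o, u.alloc j = some o → o ∈ s.items)
    (fun u w hw hu => ⟨fun a ha => hu.1 (State.mem_update_items.1 ha).1, fun a ha => ?_⟩)
    ⟨subset_rfl, by simp [hj]⟩ ht).2 o ho
  by_cases hwin : ∃ b, w b = some j
  · obtain ⟨b, hb⟩ := hwin
    rw [hw.alloc_of_wins hb, Option.some_inj] at ha
    exact hu.1 (ha ▸ (hw.isTop hb).1)
  · rw [State.alloc_of_loses (not_exists.1 hwin)] at ha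
    exact hu.2 a ha

/-! ### Expected shares -/

/-- The allocation of an agent as a `0/1` row; it is zero as long as nothing is allocated to her. -/
def allocRow (x : Option (Item n)) : Item n → ℝ := fun o => if x = some o then 1 else 0

theorem allocRow_some (a : Item n) : allocRow (some a) = Pi.single a 1 := by
  ext o
  simp [allocRow, Pi.single_apply, eq_comm]

theorem allocRow_nonneg (x : Option (Item n)) : 0 ≤ allocRow x := fun o => by
  unfold allocRow
  positivity

theorem sum_allocRow_le_one (x : Option (Item n)) : ∑ o, allocRow x o ≤ 1 := by
  cases x <;> simp [allocRow]

/-- The expected allocation of agent `j` when `r` rounds are played from the state `s`. -/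
noncomputable def share (R : Profile n) (r : ℕ) (s : State n) (j : Agent n) : Item n → ℝ :=
  expectation (loop R r s) fun t => allocRow (t.alloc j)

theorem share_zero (R : Profile n) (s : State n) (j : Agent n) :
    share R 0 s j = allocRow (s.alloc j) :=
  expectation_pure s _

theorem share_succ (R : Profile n) (r : ℕ) (s : State n) (j : Agent n) :
    share R (r + 1) s j = expectation (independentDraws fun o => lottery (s.applicants R o))
      fun w => share R r (s.update R w) j := by
  rw [share, loop_succ, expectation_bind, round, expectation_map]
  rfl

theorem share_of_notMem_agents (r : ℕ) (hj : j ∉ s.agents) :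
    share R r s j = allocRow (s.alloc j) :=
  expectation_eq_of_forall_mem_support fun t ht => by rw [alloc_eq_of_mem_support_loop ht hj]

theorem IsDraw.share_of_wins (hw : IsDraw R s w) (h : w a = some j) (r : ℕ) :
    share R r (s.update R w) j = Pi.single a 1 := by
  rw [share_of_notMem_agents r (State.notMem_update_agents h), hw.alloc_of_wins h, allocRow_some]

theorem share_eq_zero_of_notMem_items (r : ℕ) (hj : s.alloc j = none) (ho : o ∉ s.items) :
    share R r s j o = 0 := by
  rw [share, expectation_apply]
  exact expectation_eq_of_forall_mem_support fun t ht =>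
    if_neg fun h => ho (mem_items_of_mem_support_loop ht hj h)

theorem share_nonneg (R : Profile n) (r : ℕ) (s : State n) (j : Agent n) : 0 ≤ share R r s j :=
  Set.mem_Ici.1 <| expectation_mem_of_convex (convex_Ici 0) fun _ _ => allocRow_nonneg _

theorem sum_share_le_one (R : Profile n) (r : ℕ) (s : State n) (j : Agent n) :
    ∑ o, share R r s j o ≤ 1 := by
  have hlinear : IsLinearMap ℝ fun x : Item n → ℝ => ∑ o, x o :=
    ⟨fun x y => Finset.sum_add_distrib, fun c x => (Finset.mul_sum _ _ c).symm⟩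
  exact expectation_mem_of_convex (convex_halfSpace_le hlinear 1) fun _ _ => sum_allocRow_le_one _

theorem share_pos_of_mem_applicants (r : ℕ) (hj : j ∈ s.applicants R a) :
    0 < share R (r + 1) s j a := by
  obtain ⟨w, hw, hwin⟩ := exists_isDraw_of_mem_applicants hj
  rw [share_succ, expectation_apply]
  refine expectation_pos (fun w => share_nonneg _ _ _ _ a) (mem_support_draws.2 hw) ?_
  rw [hw.share_of_wins hwin, Pi.single_eq_same]
  exact one_pos

theorem share_eq_one_of_applicants_eq_singleton (r : ℕ) (h : s.applicants R a = {j}) :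
    share R (r + 1) s j a = 1 := by
  rw [share_succ, expectation_apply]
  refine expectation_eq_of_forall_mem_support fun w hw => ?_
  rw [mem_support_draws] at hw
  obtain ⟨i, hi⟩ := hw.exists_winner (o := a) (h ▸ Finset.singleton_nonempty j)
  obtain rfl : i = j := Finset.mem_singleton.1 (h ▸ hw.mem_applicants hi)
  rw [hw.share_of_wins hi, Pi.single_eq_same]

theorem share_eq_zero_of_notMem_applicants (r : ℕ) (ha : (s.applicants R a).Nonempty)
    (hj : j ∉ s.applicants R a) (hnone : s.alloc j = none) : share R (r + 1) s j a = 0 := by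
  rw [share_succ, expectation_apply]
  refine expectation_eq_of_forall_mem_support fun w hw => ?_
  rw [mem_support_draws] at hw
  by_cases hwin : ∃ o, w o = some j
  · obtain ⟨o, ho⟩ := hwin
    have hao : a ≠ o := fun h => hj (h ▸ hw.mem_applicants ho)
    rw [hw.share_of_wins ho, Pi.single_eq_of_ne hao]
  · have hlose := not_exists.1 hwin
    exact share_eq_zero_of_notMem_items r (by rw [State.alloc_of_loses hlose, hnone])
      fun h => ha.ne_empty (State.mem_update_items.1 h).2

theorem share_lt_one_of_mem_applicants (r : ℕ) (hj : j ∈ s.applicants R o) (hao : a ≠ o) :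
    share R (r + 1) s j a < 1 := by
  have hpair : share R (r + 1) s j a + share R (r + 1) s j o ≤ 1 := by
    rw [← Finset.sum_pair hao]
    exact (Finset.sum_le_univ_sum_of_nonneg (share_nonneg R (r + 1) s j)).trans
      (sum_share_le_one R (r + 1) s j)
  linarith [share_pos_of_mem_applicants r hj]

/-! ### Coupling two runs -/

/-- `R'` arises from `R` by renaming each agent `i` to `σ i`, except that `j` may change her report;
then other agents who have the new report in `R` may have the old one in `R'`. -/
def RenamesExcept (σ : Equiv.Perm (Agent n)) (j : Agent n) (R R' : Profile n) : Prop :=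
  ∀ i, i ≠ j → R' (σ i) = R i ∨ R i = R' (σ j) ∧ R' (σ i) = R j

theorem renamesExcept_swap (R : Profile n) (j k : Agent n) :
    RenamesExcept (Equiv.swap j k) j R R := fun i hij => by
  rcases eq_or_ne i k with rfl | hik
  · exact .inr ⟨by rw [Equiv.swap_apply_left], by rw [Equiv.swap_apply_right]⟩
  · exact .inl (by rw [Equiv.swap_apply_of_ne_of_ne hij hik])

theorem renamesExcept_update (R : Profile n) (j : Agent n) (p : Preference n) :
    RenamesExcept (Equiv.refl _) j R (Function.update R j p) := fun i hij =>
  .inl (by rw [Equiv.refl_apply, Function.update_of_ne hij])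

/-- The state `s'` of the second run is the state `s` of the first one with each agent `i` renamed
to `σ i`, and `j` has not been allocated anything yet in either run. -/
structure Coupled (σ : Equiv.Perm (Agent n)) (j : Agent n) (s s' : State n) : Prop where
  items_eq : s'.items = s.items
  mem_agents_iff : ∀ i, σ i ∈ s'.agents ↔ i ∈ s.agents
  mem_agents : j ∈ s.agents
  alloc_eq_none : s.alloc j = none
  alloc_eq_none' : s'.alloc (σ j) = none

section Coupling

variable {σ : Equiv.Perm (Agent n)} {s' : State n}

theorem coupled_initial (σ : Equiv.Perm (Agent n)) (j : Agent n) :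
    Coupled σ j State.initial State.initial :=
  ⟨rfl, fun _ => by simp only [State.initial, Finset.mem_univ], Finset.mem_univ j, rfl, rfl⟩

theorem Coupled.applicants_eq_map (hs : Coupled σ j s s') (hR : RenamesExcept σ j R R')
    (htop : ∀ o, (R j).IsTop s.items o ↔ (R' (σ j)).IsTop s.items o) (o : Item n) :
    s'.applicants R' o = (s.applicants R o).map σ.toEmbedding := by
  ext i
  obtain ⟨i, rfl⟩ := σ.surjective i
  rw [State.mem_applicants, hs.mem_agents_iff, hs.items_eq, Finset.mem_map_equiv,
    Equiv.symm_apply_apply, State.mem_applicants]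
  refine and_congr_right fun _ => ?_
  rcases eq_or_ne i j with rfl | hij
  · exact (htop o).symm
  · rcases hR i hij with h | ⟨hnew, hold⟩
    · rw [h]
    · rw [hnew, hold, htop]

theorem map_perm_eq_some_iff {v : Option (Agent n)} : v.map σ = some (σ i) ↔ v = some i := by
  simp only [Option.map_eq_some_iff, EmbeddingLike.apply_eq_iff_eq, exists_eq_right]

theorem IsDraw.map_perm (hw : IsDraw R s w)
    (happ : ∀ o, s'.applicants R' o = (s.applicants R o).map σ.toEmbedding) :
    IsDraw R' s' fun o => (w o).map σ := fun o => by
  rw [happ, PMF.mem_support_iff, lottery_map_perm]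
  exact (PMF.mem_support_iff _ _).1 (hw o)

theorem Coupled.update (hs : Coupled σ j s s')
    (happ : ∀ o, s'.applicants R' o = (s.applicants R o).map σ.toEmbedding)
    (hlose : ∀ o, w o ≠ some j) :
    Coupled σ j (s.update R w) (s'.update R' fun o => (w o).map σ) where
  items_eq := by
    ext o
    rw [State.mem_update_items, State.mem_update_items, happ, hs.items_eq, Finset.map_eq_empty]
  mem_agents_iff i := by
    simp only [State.mem_update_agents, hs.mem_agents_iff, ne_eq, map_perm_eq_some_iff]
  mem_agents := State.mem_update_agents.2 ⟨hs.mem_agents, hlose⟩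
  alloc_eq_none := by rw [State.alloc_of_loses hlose, hs.alloc_eq_none]
  alloc_eq_none' := by
    rw [State.alloc_of_loses fun o h => hlose o (map_perm_eq_some_iff.1 h), hs.alloc_eq_none']

theorem expectation_draws_map_perm {E : Type*} [AddCommGroup E] [Module ℝ E]
    (happ : ∀ o, s'.applicants R' o = (s.applicants R o).map σ.toEmbedding)
    (f : (Item n → Option (Agent n)) → E) :
    expectation (independentDraws fun o => lottery (s'.applicants R' o)) f =
      expectation (independentDraws fun o => lottery (s.applicants R o))
        fun w => f fun o => (w o).map σ :=
  expectation_independentDraws_equiv (Equiv.optionCongr σ)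
    (fun o v => by rw [happ]; exact lottery_map_perm _ σ v) f

theorem Coupled.share_lt_share (hs : Coupled σ j s s') (hR : RenamesExcept σ j R R') (r : ℕ)
    {b : Item n} (ha : (R j).IsTop s.items a) (hb : (R' (σ j)).IsTop s.items b) (hab : a ≠ b) :
    share R' (r + 1) s' (σ j) a < share R (r + 1) s j a := by
  have hja : j ∈ s.applicants R a := State.mem_applicants.2 ⟨hs.mem_agents, ha⟩
  have hjb : σ j ∈ s'.applicants R' b :=
    State.mem_applicants.2 ⟨(hs.mem_agents_iff j).2 hs.mem_agents, hs.items_eq ▸ hb⟩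
  rcases (s'.applicants R' a).eq_empty_or_nonempty with hempty | hnonempty
  · have hsole : s.applicants R a = {j} := by
      refine Finset.eq_singleton_iff_unique_mem.2 ⟨hja, fun i hi => by_contra fun hij => ?_⟩
      obtain ⟨hi, hia⟩ := State.mem_applicants.1 hi
      rcases hR i hij with h | ⟨hnew, -⟩
      · exact Finset.eq_empty_iff_forall_notMem.1 hempty (σ i) <|
          State.mem_applicants.2 ⟨(hs.mem_agents_iff i).2 hi, by rwa [h, hs.items_eq]⟩
      · exact hab ((hnew ▸ hia).eq hb)
    rw [share_eq_one_of_applicants_eq_singleton r hsole]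
    exact share_lt_one_of_mem_applicants r hjb hab
  · have hja' : σ j ∉ s'.applicants R' a := fun h =>
      hab ((hs.items_eq ▸ (State.mem_applicants.1 h).2).eq hb)
    rw [share_eq_zero_of_notMem_applicants r hnonempty hja' hs.alloc_eq_none']
    exact share_pos_of_mem_applicants r hja

theorem Coupled.share_sub_share_mem (hs : Coupled σ j s s') (hR : RenamesExcept σ j R R')
    (r : ℕ) : share R r s j - share R' r s' (σ j) ∈ (R j).divergenceCone (R' (σ j)) := by
  induction r generalizing s s' with
  | zero =>
    rw [share_zero, share_zero, hs.alloc_eq_none, hs.alloc_eq_none', sub_self]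
    exact zero_mem _
  | succ r ih =>
    by_cases htop : ∀ o, (R j).IsTop s.items o ↔ (R' (σ j)).IsTop s.items o
    · have happ := hs.applicants_eq_map hR htop
      rw [share_succ, share_succ, expectation_draws_map_perm happ, expectation_sub]
      refine expectation_mem_of_convex (Preference.convex_divergenceCone _ _) fun w hw => ?_
      rw [mem_support_draws] at hw
      by_cases hwin : ∃ o, w o = some j
      · obtain ⟨o, ho⟩ := hwin
        rw [hw.share_of_wins ho,
          (hw.map_perm happ).share_of_wins (map_perm_eq_some_iff.2 ho), sub_self]
        exact zero_mem ((R j).divergenceCone (R' (σ j)))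
      · exact ih (hs.update happ (not_exists.1 hwin))
    · obtain ⟨a, b, ha, hb, hab⟩ := Preference.exists_isTop_ne htop
      refine Preference.mem_divergenceCone_of_isTop_ne ha hb hab
        (sub_pos.2 (hs.share_lt_share hR r ha hb hab)) fun o ho => ?_
      rw [Pi.sub_apply, share_eq_zero_of_notMem_items _ hs.alloc_eq_none ho,
        share_eq_zero_of_notMem_items _ hs.alloc_eq_none' (hs.items_eq ▸ ho), sub_self]

end Coupling

theorem expectedOutcome_eq_expectation (R : Profile n) :
    expectedOutcome R =
      expectation (loop R n State.initial) fun t => Matrix.of fun j => allocRow (t.alloc j) := by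
  rw [← expectation_map (loop R n State.initial) State.alloc
    fun A => Matrix.of fun j => allocRow (A j)]
  ext j o
  rw [expectation, Matrix.sum_apply]
  rfl

theorem expectedOutcome_apply (R : Profile n) (j : Agent n) :
    expectedOutcome R j = share R n State.initial j := by
  rw [expectedOutcome_eq_expectation]
  exact expectation_apply _ _ j

theorem expectedOutcome_sub_mem_divergenceCone {σ : Equiv.Perm (Agent n)}
    (hR : RenamesExcept σ j R R') :
    expectedOutcome R j - expectedOutcome R' (σ j) ∈ (R j).divergenceCone (R' (σ j)) := by
  rw [expectedOutcome_apply, expectedOutcome_apply]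
  exact (coupled_initial σ j).share_sub_share_mem hR n

theorem expectedOutcome_sub_mem_divergenceCone_of_agents (R : Profile n) (j k : Agent n) :
    expectedOutcome R j - expectedOutcome R k ∈ (R j).divergenceCone (R k) := by
  simpa only [Equiv.swap_apply_left] using
    expectedOutcome_sub_mem_divergenceCone (renamesExcept_swap R j k)

theorem sdWeakEnvyFree_expectedOutcome (R : Profile n) :
    SdWeakEnvyFree R (expectedOutcome R) := fun j k h =>
  h.eq_of_sub_mem_divergenceCone (expectedOutcome_sub_mem_divergenceCone_of_agents R j k)

theorem strongEqualTreatmentOfEquals_expectedOutcome (R : Profile n) :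
    StrongEqualTreatmentOfEquals R (expectedOutcome R) := fun j k _ hC _ ho =>
  sub_eq_zero.1 <| hC.eq_zero_of_mem_divergenceCone
    (expectedOutcome_sub_mem_divergenceCone_of_agents R j k) ho

theorem sdWeakStrategyproof_expectedOutcome :
    SdWeakStrategyproof (expectedOutcome : Profile n → ShareMatrix n) := fun R j p h =>
  (h.eq_of_sub_mem_divergenceCone
    (expectedOutcome_sub_mem_divergenceCone (renamesExcept_update R j p))).symm

/-! ### Ex-post FERI -/

/-- The allocation is one-to-one, the remaining agents are those to whom nothing is allocated, and
the remaining items are those that are allocated to nobody. -/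
structure State.Consistent (s : State n) : Prop where
  mem_agents_iff : ∀ j, j ∈ s.agents ↔ s.alloc j = none
  mem_items_iff : ∀ o, o ∈ s.items ↔ ∀ j, s.alloc j ≠ some o
  alloc_inj : ∀ i j o, s.alloc i = some o → s.alloc j = some o → i = j

theorem State.consistent_initial : (State.initial : State n).Consistent :=
  ⟨by simp [State.initial], by simp [State.initial], by simp [State.initial]⟩

theorem IsDraw.update_alloc_eq_some_iff (hw : IsDraw R s w) (hs : s.Consistent) :
    (s.update R w).alloc j = some o ↔ w o = some j ∨ s.alloc j = some o := by
  by_cases hwin : ∃ a, w a = some j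
  · obtain ⟨a, ha⟩ := hwin
    have hnone : s.alloc j = none := (hs.mem_agents_iff j).1 (hw.mem_agents ha)
    simp only [hw.alloc_of_wins ha, hnone, Option.some_inj, reduceCtorEq, or_false]
    exact ⟨fun h => h ▸ ha, fun h => (hw.isTop ha).eq (hw.isTop h)⟩
  · have hlose := not_exists.1 hwin
    rw [State.alloc_of_loses hlose, or_iff_right (hlose o)]

theorem State.Consistent.update (hs : s.Consistent) (hw : IsDraw R s w) :
    (s.update R w).Consistent where
  mem_agents_iff j := by
    rw [State.mem_update_agents, hs.mem_agents_iff, Option.eq_none_iff_forall_ne_some,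
      Option.eq_none_iff_forall_ne_some, ← forall_and]
    simp only [ne_eq, hw.update_alloc_eq_some_iff hs, not_or, and_comm]
  mem_items_iff o := by
    have hunwon : s.applicants R o = ∅ ↔ ∀ j, w o ≠ some j := by
      rw [← Finset.not_nonempty_iff_eq_empty, ← not_exists]
      exact not_congr ⟨hw.exists_winner, fun ⟨j, hj⟩ => ⟨j, hw.mem_applicants hj⟩⟩
    rw [State.mem_update_items, hs.mem_items_iff, hunwon, ← forall_and]
    simp only [ne_eq, hw.update_alloc_eq_some_iff hs, not_or, and_comm]
  alloc_inj i j o hi hj := by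
    rw [hw.update_alloc_eq_some_iff hs] at hi hj
    rcases hi with hi | hi <;> rcases hj with hj | hj
    · exact Option.some_inj.1 (hi.symm.trans hj)
    · exact absurd hj ((hs.mem_items_iff o).1 (hw.isTop hi).1 j)
    · exact absurd hi ((hs.mem_items_iff o).1 (hw.isTop hj).1 i)
    · exact hs.alloc_inj i j o hi hj

theorem State.Consistent.of_mem_support_loop (hs : s.Consistent) {r : ℕ}
    (ht : t ∈ (loop R r s).support) : t.Consistent :=
  loop_invariant (fun _ _ hw hu => hu.update hw) hs ht

theorem State.Consistent.agents_nonempty (hs : s.Consistent) (hitems : s.items.Nonempty) :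
    s.agents.Nonempty := by
  by_contra hempty
  have hsome (j : Agent n) : ∃ o, s.alloc j = some o := Option.ne_none_iff_exists'.1 fun hj =>
    hempty ⟨j, (hs.mem_agents_iff j).2 hj⟩
  choose A hA using hsome
  have hinj : Function.Injective A := fun i j hij =>
    hs.alloc_inj i j (A i) (hA i) (hij ▸ hA j)
  obtain ⟨o, ho⟩ := hitems
  obtain ⟨j, rfl⟩ := Finite.injective_iff_surjective.1 hinj o
  exact (hs.mem_items_iff _).1 ho j (hA j)

theorem State.Consistent.card_update_items_le (hs : s.Consistent) {r : ℕ}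
    (hr : s.items.card ≤ r + 1) (w : Item n → Option (Agent n)) :
    (s.update R w).items.card ≤ r := by
  have hsub : (s.update R w).items ⊆ s.items := fun o ho => (State.mem_update_items.1 ho).1
  rcases s.items.eq_empty_or_nonempty with hempty | hitems
  · exact (Finset.card_le_card (hsub.trans hempty.subset)).trans (Nat.zero_le r)
  · obtain ⟨j, hj⟩ := hs.agents_nonempty hitems
    obtain ⟨a, ha⟩ := (R j).exists_isTop hitems
    have hja : j ∈ s.applicants R a := State.mem_applicants.2 ⟨hj, ha⟩
    have hgone : a ∉ (s.update R w).items := fun h =>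
      Finset.ne_empty_of_mem hja (State.mem_update_items.1 h).2
    have := Finset.card_lt_card (Finset.ssubset_iff_of_subset hsub |>.2 ⟨a, ha.1, hgone⟩)
    omega

theorem State.Consistent.items_eq_empty_of_mem_support_loop (hs : s.Consistent) {r : ℕ}
    (hr : s.items.card ≤ r) (ht : t ∈ (loop R r s).support) : t.items = ∅ := by
  induction r generalizing s with
  | zero => rw [(PMF.mem_support_pure_iff s t).1 ht, Finset.card_eq_zero.1 (Nat.le_zero.1 hr)]
  | succ r ih =>
    obtain ⟨w, hw, ht⟩ := mem_support_loop_succ.1 ht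
    exact ih (hs.update hw) (hs.card_update_items_le hr w) ht

theorem State.Consistent.exists_assignment (hs : s.Consistent) (hempty : s.items = ∅) :
    ∃ A : DetAssignment n, ∀ j, s.alloc j = some (A j) := by
  have howner (o : Item n) : ∃ j, s.alloc j = some o := by
    by_contra! h
    simpa [hempty] using (hs.mem_items_iff o).2 h
  choose owner howner using howner
  have hinj : Function.Injective owner := fun o o' h =>
    Option.some_inj.1 ((howner o).symm.trans (h ▸ howner o'))
  let e := Equiv.ofBijective owner (Finite.injective_iff_bijective.1 hinj)
  refine ⟨e.symm, fun j => ?_⟩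
  obtain ⟨o, rfl⟩ := e.surjective j
  rw [Equiv.symm_apply_apply]
  exact howner o

theorem mem_nextTier {A : DetAssignment n} {U : Finset (Item n)} :
    o ∈ nextTier R A U ↔ ∃ j, A j ∉ U ∧ (R j).IsTop Uᶜ o := by
  simp only [nextTier, Finset.mem_filter_univ]

theorem monotone_tiersBefore (R : Profile n) (A : DetAssignment n) :
    Monotone (tiersBefore R A) :=
  monotone_nat_of_le_succ fun _ => Finset.subset_union_left

section Tiers

variable {A : DetAssignment n} {m r : ℕ}

theorem State.Consistent.assigned_mem_items_iff (hs : s.Consistent)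
    (ht : t ∈ (loop R m s).support) (hA : ∀ j, t.alloc j = some (A j)) :
    A j ∈ s.items ↔ j ∈ s.agents := by
  constructor
  · refine fun hj => by_contra fun hout => (hs.mem_items_iff _).1 hj j ?_
    rw [← alloc_eq_of_mem_support_loop ht hout, hA]
  · exact fun hj => mem_items_of_mem_support_loop ht ((hs.mem_agents_iff j).1 hj) (hA j)

theorem mem_tier_iff_applicants_nonempty (hagents : ∀ j, A j ∈ s.items ↔ j ∈ s.agents)
    (hr : tiersBefore R A r = s.itemsᶜ) : o ∈ tier R A r ↔ (s.applicants R o).Nonempty := by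
  simp only [tier, hr, mem_nextTier, Finset.mem_compl, not_not, compl_compl, hagents,
    Finset.Nonempty, State.mem_applicants]

theorem tiersBefore_succ_eq_compl_update_items (hagents : ∀ j, A j ∈ s.items ↔ j ∈ s.agents)
    (hr : tiersBefore R A r = s.itemsᶜ) (w : Item n → Option (Agent n)) :
    tiersBefore R A (r + 1) = (s.update R w).itemsᶜ := by
  ext o
  change o ∈ tiersBefore R A r ∪ tier R A r ↔ _
  rw [Finset.mem_union, mem_tier_iff_applicants_nonempty hagents hr, hr, Finset.mem_compl,
    Finset.mem_compl, State.mem_update_items, not_and_or, Finset.nonempty_iff_ne_empty]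

theorem IsDraw.isTop_symm_of_applicants_nonempty (hw : IsDraw R s w)
    (ht : t ∈ (loop R m (s.update R w)).support) (hA : ∀ j, t.alloc j = some (A j))
    (ho : (s.applicants R o).Nonempty) : (R (A.symm o)).IsTop s.items o := by
  obtain ⟨j, hj⟩ := hw.exists_winner ho
  have hjo : A j = o := by
    rw [← Option.some_inj, ← hA,
      alloc_eq_of_mem_support_loop ht (State.notMem_update_agents hj), hw.alloc_of_wins hj]
  rw [← hjo, A.symm_apply_apply, hjo]
  exact hw.isTop hj

theorem isTop_of_mem_tier_add (hs : s.Consistent) (hm : s.items.card ≤ m)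
    (ht : t ∈ (loop R m s).support) (hA : ∀ j, t.alloc j = some (A j))
    (hr : tiersBefore R A r = s.itemsᶜ) (k : ℕ) (ho : o ∈ tier R A (r + k)) :
    (R (A.symm o)).IsTop (tiersBefore R A (r + k))ᶜ o := by
  induction m generalizing s r k with
  | zero =>
    obtain ⟨j, hj, -⟩ := mem_nextTier.1 ho
    have hall : A j ∈ tiersBefore R A r := by
      simp [hr, Finset.card_eq_zero.1 (Nat.le_zero.1 hm)]
    exact absurd (monotone_tiersBefore R A (Nat.le_add_right r k) hall) hj
  | succ m ih =>
    have hagents (j : Agent n) : A j ∈ s.items ↔ j ∈ s.agents := hs.assigned_mem_items_iff ht hA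
    obtain ⟨w, hw, ht⟩ := mem_support_loop_succ.1 ht
    cases k with
    | zero =>
      rw [Nat.add_zero, mem_tier_iff_applicants_nonempty hagents hr] at ho
      rw [Nat.add_zero, hr, compl_compl]
      exact hw.isTop_symm_of_applicants_nonempty ht hA ho
    | succ k =>
      rw [← Nat.succ_add_eq_add_succ] at ho ⊢
      exact ih (hs.update hw) (hs.card_update_items_le hm w) ht
        (tiersBefore_succ_eq_compl_update_items hagents hr w) k ho

end Tiers

theorem exists_feri_of_mem_support_loop (ht : t ∈ (loop R n State.initial).support) :
    ∃ A : DetAssignment n, FERI R A ∧ ∀ j, t.alloc j = some (A j) := by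
  have hs := State.consistent_initial (n := n)
  have hcard : (State.initial : State n).items.card ≤ n := by simp [State.initial]
  obtain ⟨A, hA⟩ := (hs.of_mem_support_loop ht).exists_assignment
    (hs.items_eq_empty_of_mem_support_loop hcard ht)
  refine ⟨A, fun r o ho => ?_, hA⟩
  rw [← Nat.zero_add r] at ho ⊢
  exact isTop_of_mem_tier_add hs hcard ht hA (by simp [tiersBefore, State.initial]) r ho

theorem exPost_feri_expectedOutcome (R : Profile n) : ExPost (FERI R) (expectedOutcome R) := by
  rw [expectedOutcome_eq_expectation]
  refine expectation_mem_of_convex (convex_convexHull ℝ _) fun t ht => ?_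
  obtain ⟨A, hFERI, hA⟩ := exists_feri_of_mem_support_loop ht
  refine subset_convexHull ℝ _ ⟨A, hFERI, ?_⟩
  ext j o
  simp [DetAssignment.toMatrix, allocRow, hA]

end EBM

theorem ExPost.isRandomAssignment {n : ℕ} {X : DetAssignment n → Prop} {P : ShareMatrix n}
    (h : ExPost X P) : IsRandomAssignment P := by
  refine convexHull_min ?_ convex_doublyStochastic h
  rintro _ ⟨A, -, rfl⟩
  refine mem_doublyStochastic_iff_sum.2 ⟨fun j o => ?_, fun j => ?_, fun o => ?_⟩
  · unfold DetAssignment.toMatrix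
    positivity
  · simp [DetAssignment.toMatrix]
  · simp [DetAssignment.toMatrix, ← Equiv.eq_symm_apply]

/-- The expected outcome of the eager Boston mechanism is a random assignment that satisfies ex-post
FERI, sd-weak-envy-freeness and strong equal treatment of equals, for every preference profile, and
the mechanism is sd-weakly strategyproof. -/
theorem mainTheorem1 (n : ℕ) :
    (∀ R : Profile n,
      IsRandomAssignment (EBM.expectedOutcome R) ∧
      ExPost (FERI R) (EBM.expectedOutcome R) ∧
      SdWeakEnvyFree R (EBM.expectedOutcome R) ∧
      StrongEqualTreatmentOfEquals R (EBM.expectedOutcome R)) ∧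
    SdWeakStrategyproof (EBM.expectedOutcome : Profile n → ShareMatrix n) := by
  refine ⟨fun R => ?_, EBM.sdWeakStrategyproof_expectedOutcome⟩
  have hFERI := EBM.exPost_feri_expectedOutcome R
  exact ⟨hFERI.isRandomAssignment, hFERI, EBM.sdWeakEnvyFree_expectedOutcome R,
    EBM.strongEqualTreatmentOfEquals_expectedOutcome R⟩
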